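/- **Setting.** Let $V_1,V_2$ be non-zero separable complex Hilbert spaces and, for $i\in\{1,2\}$, let $P_{i},Q_{i}$ be orthogonal projections on $V_i$. Put $A_1=2P_1-\mathrm{id}$, $A_2=2Q_1-\mathrm{id}$ on $V_1$ and $B_1=2P_2-\mathrm{id}$, $B_2=2Q_2-\mathrm{id}$ on $V_2$. The Bell-CHSH operator on the Hilbert space tensor product $V_1\otimes V_2$ is $$\mathcal B=A_1\otimes(B_1+B_2)+A_2\otimes(B_1-B_2),$$ and $\rho(\mathcal B)$ is its spectral radius. Put $b(\lambda)=|\lambda|\sqrt{4-\lambda^2}$ for $\lambda\in[-2,2]$. **Assumption and approximations.** Let $(V,P,Q)$ be $(V_1,P_1,Q_1)$ or $(V_2,P_2,Q_2)$. Assume that one of the following holds, and let $\mathcal A=\{(V^{(n)},P^{(n)},Q^{(n)})\}_{n\ge1}$ be the approximation described there. * Case 1: $V$ is the orthogonal (Hilbert) direct sum of an at most countable family $(W_j)_{j\in J}$ of finite-dimensional subspaces invariant under $P$ and $Q$. Then, for some such family and some increasing sequence of finite sets $J_1\subset J_2\subset\cdots$ with union $J$, $V^{(n)}=\bigoplus_{j\in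 J_n}W_j$, and $P^{(n)},Q^{(n)}$ are the restrictions of $P,Q$ to $V^{(n)}$. * Case 2: Case 1 fails and $(P,Q)$ has a one-shifted form: there are an orthonormal basis $e_1,e_2,\dots$ of $V$ and angles $\theta_1,\theta_2,\dots\in(0,\pi)$ such that, with $R(\theta)=\frac12\begin{pmatrix}1+\cos\theta&\sin\theta\\ \sin\theta&1-\cos\theta\end{pmatrix}$, $P$ acts on $\mathrm{span}(e_{2k-1},e_{2k})$ by $R(\theta_{2k-1})$ for all $k\ge1$, while $Qe_1=e_1$ and $Q$ acts on $\mathrm{span}(e_{2k},e_{2k+1})$ by $R(\theta_{2k})$ for all $k\ge1$. Then, for some such basis, $V^{(n)}=\mathrm{span}(e_1,\dots,e_{2n})$, $P^{(n)}=P|_{V^{(n)}}$, and $Q^{(n)}e_j=Qe_j$ for $j<2n$, $Q^{(n)}e_{2n}=0$. Write $S=2(P+Q-\mathrm{id})$ and $S^{(n)}=2(P^{(n)}+Q^{(n)}-\mathrm{id})$. The finite dimensional approximate point spectrum of $S$ is the set of limits $\lambda=\lim\lambda^{(n)}$ of eigenvalues $\lambda^{(n)}$ of $S^{(n)}$ that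 have unit eigenvectors $u^{(n)}\in V^{(n)}$ with $\|Su^{(n)}-S^{(n)}u^{(n)}\|\to0$ (all for sufficiently large $n$). Let $F(S)$ be the set of $\lambda\in(0,2)$ such that both $\lambda$ and $-\lambda$ are in it, and let $\tilde F(S)=F(S)\cup\{0\}$. For $i\in\{1,2\}$ and all large $n$, let $\lambda_{i,n}$ be an eigenvalue of $S^{(n)}$ for the side $i$ whose square is closest to $2$ among all eigenvalues of $S^{(n)}$ (so $b(\lambda_{i,n})$ is the largest value of $b$ on the eigenvalues of $S^{(n)}$). **Theorem.** $$\sup_{\lambda\in\tilde F(A_1+A_2),\ \lambda'\in\tilde F(B_1+B_2)}\sqrt{4+b(\lambda)b(\lambda')}\ \le\ \rho(\mathcal B)\ \le\ \liminf_{n\to\infty}\sqrt{4+b(\lambda_{1,n})\,b(\lambda_{2,n})}.$$ -/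

import Mathlib

open Filter Topology TensorProduct

noncomputable section

namespace BellCHSH

variable {V : Type*} [NormedAddCommGroup V] [InnerProductSpace ℂ V]

/-- The reflection (dichotomic observable) `2P - id` attached to a projection `P`. -/
def reflection (P : V →L[ℂ] V) : V →L[ℂ] V := (2 : ℂ) • P - ContinuousLinearMap.id ℂ V

/-- The operator `A + B`, where `A = 2P - id` and `B = 2Q - id`. -/
def sumOp (P Q : V →L[ℂ] V) : V →L[ℂ] V := reflection P + reflection Q

/-- The function `b(λ) = |λ| √(4 - λ²)`, used for `λ ∈ [-2, 2]`. -/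
def b (l : ℝ) : ℝ := |l| * √(4 - l ^ 2)

/-- A finite dimensional subspace of `V` together with two orthogonal projections on it:
one term `(Vₙ, {Pₙ, Qₙ})` of a finite dimensional approximation. -/
structure FiniteDimPair (V : Type*) [NormedAddCommGroup V] [InnerProductSpace ℂ V] where
  space : Submodule ℂ V
  finiteDimensional : FiniteDimensional ℂ space
  P : space →ₗ[ℂ] space
  Q : space →ₗ[ℂ] space
  isSymmetricProjection_P : P.IsSymmetricProjection
  isSymmetricProjection_Q : Q.IsSymmetricProjection

/-- The operator `Aₙ + Bₙ` on `Vₙ`, where `Aₙ = 2Pₙ - id` and `Bₙ = 2Qₙ - id`. -/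
def FiniteDimPair.sumOp (X : FiniteDimPair V) : X.space →ₗ[ℂ] X.space :=
  ((2 : ℂ) • X.P - LinearMap.id) + ((2 : ℂ) • X.Q - LinearMap.id)

/-- `V` is the Hilbert space direct sum of the pairwise orthogonal, finite dimensional subspaces
`W i`, and each of them is invariant under `P` and `Q`. -/
structure IsInvariantDecomposition (P Q : V →L[ℂ] V) {ι : Type} (W : ι → Submodule ℂ V) :
    Prop where
  orthogonal : OrthogonalFamily ℂ (fun i => W i) (fun i => (W i).subtypeₗᵢ)
  dense : (⨆ i, W i).topologicalClosure = ⊤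
  finiteDimensional : ∀ i, FiniteDimensional ℂ (W i)
  map_P : ∀ i, ∀ x ∈ W i, P x ∈ W i
  map_Q : ∀ i, ∀ x ∈ W i, Q x ∈ W i

/-- The pair `(P, Q)` decomposes into at most countably many finite dimensional
invariant pieces. -/
def DecomposesFinitely (P Q : V →L[ℂ] V) : Prop :=
  ∃ (ι : Type) (_ : Countable ι) (W : ι → Submodule ℂ V), IsInvariantDecomposition P Q W

/-- The approximation attached to an orthogonal decomposition `W` into finite dimensional
invariant subspaces and to finite sets `I n` of indices: `Vₙ` is the sum of the `W i`, `i ∈ I n`,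
and `Pₙ`, `Qₙ` are the restrictions of `P`, `Q`. -/
structure IsDecompositionApprox (P Q : V →L[ℂ] V) {ι : Type} (W : ι → Submodule ℂ V)
    (I : ℕ → Finset ι) (𝒜 : ℕ → FiniteDimPair V) : Prop where
  monotone : Monotone I
  exhaust : ∀ i, ∃ n, i ∈ I n
  space_eq : ∀ n, (𝒜 n).space = ⨆ i ∈ I n, W i
  P_apply : ∀ n (x : (𝒜 n).space), ((𝒜 n).P x : V) = P x
  Q_apply : ∀ n (x : (𝒜 n).space), ((𝒜 n).Q x : V) = Q x

/-- `T` acts on the pair of vectors `(x, y)` through the rank one projection matrix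
`½ [[1 + cos t, sin t], [sin t, 1 - cos t]]`, so that `2T - id` acts through
`[[cos t, sin t], [sin t, -cos t]]`. -/
def ActsAsBlock (T : V →L[ℂ] V) (t : ℝ) (x y : V) : Prop :=
  T x = (((1 + Real.cos t) / 2 : ℝ) : ℂ) • x + ((Real.sin t / 2 : ℝ) : ℂ) • y ∧
  T y = ((Real.sin t / 2 : ℝ) : ℂ) • x + (((1 - Real.cos t) / 2 : ℝ) : ℂ) • y

/-- `(P, Q)` is in one-shifted form with respect to the orthonormal basis `e₀, e₁, e₂, …` with
angles `θ₀, θ₁, … ∈ (0, π)`: `P` is the direct sum of `2 × 2` blocks on `(e₀, e₁), (e₂, e₃), …`,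
whereas `Q` fixes `e₀` and is the direct sum of `2 × 2` blocks on `(e₁, e₂), (e₃, e₄), …`. -/
structure IsOneShifted (P Q : V →L[ℂ] V) (e : HilbertBasis ℕ ℂ V) (θ : ℕ → ℝ) : Prop where
  angle_mem : ∀ k, θ k ∈ Set.Ioo 0 Real.pi
  P_block : ∀ k, ActsAsBlock P (θ (2 * k)) (e (2 * k)) (e (2 * k + 1))
  Q_zero : Q (e 0) = e 0
  Q_block : ∀ k, ActsAsBlock Q (θ (2 * k + 1)) (e (2 * k + 1)) (e (2 * k + 2))

/-- The approximation attached to a one-shifted form: the `n`-th space (`n = 0, 1, 2, …`) is spanned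
by the first `2(n+1)` basis vectors, `Pₙ` is the restriction of `P` to it, and `Qₙ` agrees with `Q`
on all these basis vectors but the last one, which `Qₙ` sends to `0`. -/
structure IsOneShiftedApprox (P Q : V →L[ℂ] V) (e : HilbertBasis ℕ ℂ V)
    (𝒜 : ℕ → FiniteDimPair V) : Prop where
  space_eq : ∀ n, (𝒜 n).space = Submodule.span ℂ (e '' {j | j < 2 * (n + 1)})
  P_apply : ∀ n (x : (𝒜 n).space), ((𝒜 n).P x : V) = P x
  Q_apply : ∀ n, ∀ j < 2 * n + 1, ∀ x : (𝒜 n).space, (x : V) = e j → ((𝒜 n).Q x : V) = Q (e j)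
  Q_last : ∀ n, ∀ x : (𝒜 n).space, (x : V) = e (2 * n + 1) → (𝒜 n).Q x = 0

/-- `(V, {P, Q})` falls under one of the two cases and `𝒜` is the approximation belonging to that
case: the pair decomposes into finite dimensional invariant pieces and `𝒜` is given by such a
decomposition, or it does not so decompose but has a one-shifted form, and `𝒜` is given by such
a form. -/
inductive IsCanonicalApprox (P Q : V →L[ℂ] V) (𝒜 : ℕ → FiniteDimPair V) : Prop
  | decomposition (ι : Type) (hι : Countable ι) (W : ι → Submodule ℂ V) (I : ℕ → Finset ι)
      (hW : IsInvariantDecomposition P Q W) (h𝒜 : IsDecompositionApprox P Q W I 𝒜) :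
      IsCanonicalApprox P Q 𝒜
  | oneShifted (hPQ : ¬ DecomposesFinitely P Q) (e : HilbertBasis ℕ ℂ V) (θ : ℕ → ℝ)
      (he : IsOneShifted P Q e θ) (h𝒜 : IsOneShiftedApprox P Q e 𝒜) :
      IsCanonicalApprox P Q 𝒜

/-- The (real) finite dimensional approximate point spectrum of `A + B` corresponding to `𝒜`:
the limits `l` of eigenvalues `lₙ` of `Aₙ + Bₙ` for which there are unit eigenvectors `uₙ ∈ Vₙ` with
`‖(A + B) uₙ - (Aₙ + Bₙ) uₙ‖ → 0`. Only large `n` matter, as `Vₙ` may be zero for small `n`. -/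
def finDimApproxPointSpectrum (P Q : V →L[ℂ] V) (𝒜 : ℕ → FiniteDimPair V) : Set ℝ :=
  {l | ∃ (lam : ℕ → ℝ) (u : ∀ n, (𝒜 n).space),
    (∀ᶠ n in atTop, ‖u n‖ = 1 ∧ (𝒜 n).sumOp (u n) = (lam n : ℂ) • u n) ∧
    Tendsto lam atTop (𝓝 l) ∧
    Tendsto (fun n => ‖sumOp P Q (u n : V) - ((𝒜 n).sumOp (u n) : V)‖) atTop (𝓝 0)}

/-- The set `F(A + B)` of all `l ∈ (0, 2)` such that `l` and `-l` belong to the finite dimensional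
approximate point spectrum of `A + B`. -/
def F (P Q : V →L[ℂ] V) (𝒜 : ℕ → FiniteDimPair V) : Set ℝ :=
  {l | l ∈ Set.Ioo 0 2 ∧ l ∈ finDimApproxPointSpectrum P Q 𝒜 ∧
    -l ∈ finDimApproxPointSpectrum P Q 𝒜}

/-- The set `F̃(A + B) = F(A + B) ∪ {0}`. -/
def Ftilde (P Q : V →L[ℂ] V) (𝒜 : ℕ → FiniteDimPair V) : Set ℝ := F P Q 𝒜 ∪ {0}

/-- `l` is an eigenvalue of `Aₙ + Bₙ` whose square is closest to `2`, i.e. whose absolute value is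
closest to `√2`, distances being measured between the squares. -/
def IsNearestEigenvalue (X : FiniteDimPair V) (l : ℝ) : Prop :=
  Module.End.HasEigenvalue X.sumOp (l : ℂ) ∧
    ∀ m : ℝ, Module.End.HasEigenvalue X.sumOp (m : ℂ) → |l ^ 2 - 2| ≤ |m ^ 2 - 2|

variable {W : Type*} [NormedAddCommGroup W] [InnerProductSpace ℂ W]

/-- The Hilbert space tensor product: the completion of the algebraic tensor product for the inner
product with `⟪v ⊗ w, v' ⊗ w'⟫ = ⟪v, v'⟫ ⟪w, w'⟫`. -/
abbrev HilbertTensor (V W : Type*) [NormedAddCommGroup V] [InnerProductSpace ℂ V]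
    [NormedAddCommGroup W] [InnerProductSpace ℂ W] : Type _ :=
  UniformSpace.Completion (V ⊗[ℂ] W)

/-- The bounded operator `S ⊗ T` on the Hilbert space tensor product. -/
def tensorOp (S : V →L[ℂ] V) (T : W →L[ℂ] W) : HilbertTensor V W →L[ℂ] HilbertTensor V W :=
  ((UniformSpace.Completion.toComplL (𝕜 := ℂ) (E := V ⊗[ℂ] W)).comp
    (TensorProduct.mapL S T)).extend UniformSpace.Completion.toComplL

theorem tensorOp_coe (S : V →L[ℂ] V) (T : W →L[ℂ] W) (x : V ⊗[ℂ] W) :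
    tensorOp S T (x : HilbertTensor V W) = (TensorProduct.mapL S T x : V ⊗[ℂ] W) :=
  ContinuousLinearMap.extend_eq _ UniformSpace.Completion.denseRange_coe
    (UniformSpace.Completion.isUniformInducing_coe _) x

/-- The Bell-CHSH operator `A₁ ⊗ (B₁ + B₂) + A₂ ⊗ (B₁ - B₂)`. -/
def bellCHSH (A₁ A₂ : V →L[ℂ] V) (B₁ B₂ : W →L[ℂ] W) :
    HilbertTensor V W →L[ℂ] HilbertTensor V W :=
  tensorOp A₁ (B₁ + B₂) + tensorOp A₂ (B₁ - B₂)

end BellCHSH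

end

open Filter Topology TensorProduct

noncomputable section

namespace BellCHSH

/-! ### Pairs of involutive isometries and the square of their sum -/

section Involutions

variable {E : Type*} [NormedAddCommGroup E] [InnerProductSpace ℂ E]

/-! Write $C=[A_1,A_2]$ and $D=[B_1,B_2]$. As the four reflections are involutions, $\mathcal
B^2=4+(iC)\otimes(iD)$ (`bellCHSH_mul_self`). This gives $\|\mathcal B\|^2=4+\|C\|\,\|D\|$
(`norm_bellCHSH_sq`). The upper bound is the triangle inequality. For the lower bound, $A_1$
anticommutes with $iC$, so the Rayleigh quotients of $iC$ are symmetric about $0$ and their supremum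
is $\|C\|$ itself; the same holds for $iD$, and product vectors then suffice. Since $\mathcal B$ is
self-adjoint, its norm is its spectral radius.

It remains to compare $\|C\|$ with values of $b$. With $S=A+B$, the parallelogram law for $ABx$ and
$BAx$ reads $\|[A,B]x\|^2+\|(S^2-2)x\|^2=4\|x\|^2$, so the commutator stretches an eigenvector of
$S$ for $\lambda$ by exactly $\sqrt{4-(\lambda^2-2)^2}=b(\lambda)$. Approximate eigenvectors give
$b(\lambda)\le\|C\|$ on $\tilde F$ (`b_le_norm_commutatorOp`). Conversely, the commutator on
$V^{(n)}$ has norm at most $b(\lambda_n)$, and on a dense subspace it eventually agrees with $C$, so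
$\|C\|\le\liminf b(\lambda_n)$ (`IsCanonicalApprox.tendsto_min`). -/

theorem norm_commutator_sq_add_norm_sq {A B : E →ₗ[ℂ] E} (hA : ∀ x, A (A x) = x)
    (hB : ∀ x, B (B x) = x) (nA : ∀ x, ‖A x‖ = ‖x‖) (nB : ∀ x, ‖B x‖ = ‖x‖) (x : E) :
    ‖A (B x) - B (A x)‖ ^ 2 + ‖(A + B) ((A + B) x) - (2 : ℂ) • x‖ ^ 2 = 4 * ‖x‖ ^ 2 := by
  have h : (A + B) ((A + B) x) - (2 : ℂ) • x = A (B x) + B (A x) := by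
    simp only [LinearMap.add_apply, map_add, hA, hB, two_smul]
    abel
  have := parallelogram_law_with_norm ℂ (A (B x)) (B (A x))
  rw [nA, nB, nB, nA] at this
  rw [h]
  linarith

/-- The reflection `2p - id` attached to a linear map `p`. -/
def linearReflection (p : E →ₗ[ℂ] E) : E →ₗ[ℂ] E := (2 : ℂ) • p - LinearMap.id

theorem linearReflection_apply (p : E →ₗ[ℂ] E) (x : E) :
    linearReflection p x = (2 : ℂ) • p x - x := rfl

theorem linearReflection_involutive {p : E →ₗ[ℂ] E} (hp : p.IsSymmetricProjection)
    (x : E) : linearReflection p (linearReflection p x) = x := by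
  have h : p (p x) = p x := LinearMap.congr_fun hp.isIdempotentElem x
  simp only [linearReflection_apply, map_sub, map_smul, h]
  module

theorem linearReflection_isSymmetric {p : E →ₗ[ℂ] E}
    (hp : p.IsSymmetricProjection) : (linearReflection p).IsSymmetric :=
  (hp.isSymmetric.smul (Complex.conj_ofNat 2)).sub LinearMap.IsSymmetric.id

theorem norm_linearReflection {p : E →ₗ[ℂ] E} (hp : p.IsSymmetricProjection)
    (x : E) : ‖linearReflection p x‖ = ‖x‖ := by
  have h := linearReflection_isSymmetric hp x (linearReflection p x)
  rw [linearReflection_involutive hp, inner_self_eq_norm_sq_to_K,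
    inner_self_eq_norm_sq_to_K] at h
  exact (sq_eq_sq₀ (norm_nonneg _) (norm_nonneg _)).1 (by exact_mod_cast h)

/-- In an orthonormal eigenbasis $S^2-2$ multiplies each coordinate by $\lambda_i^2-2$. -/
theorem le_norm_apply_apply_sub_two_smul [FiniteDimensional ℂ E] {S : E →ₗ[ℂ] E}
    (hS : S.IsSymmetric) {c : ℝ} (hc : 0 ≤ c)
    (h : ∀ m : ℝ, Module.End.HasEigenvalue S (m : ℂ) → c ≤ |m ^ 2 - 2|) (x : E) :
    c * ‖x‖ ≤ ‖S (S x) - (2 : ℂ) • x‖ := by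
  have hn : Module.finrank ℂ E = Module.finrank ℂ E := rfl
  set v := hS.eigenvectorBasis hn
  have key (i) : ‖v.repr (S (S x) - (2 : ℂ) • x) i‖
      = |(hS.eigenvalues hn i) ^ 2 - 2| * ‖v.repr x i‖ := by
    rw [map_sub, map_smul, PiLp.sub_apply, PiLp.smul_apply,
      hS.eigenvectorBasis_apply_self_apply, hS.eigenvectorBasis_apply_self_apply, smul_eq_mul,
      ← mul_assoc, ← sub_mul, norm_mul, ← Real.norm_eq_abs, ← Complex.norm_real]
    congr 2
    push_cast
    simp [sq]
  rw [← v.repr.norm_map x, ← v.repr.norm_map (S (S x) - (2 : ℂ) • x)]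
  refine (sq_le_sq₀ (by positivity) (norm_nonneg _)).1 ?_
  rw [mul_pow, EuclideanSpace.norm_sq_eq, EuclideanSpace.norm_sq_eq, Finset.mul_sum]
  refine Finset.sum_le_sum fun i _ => ?_
  rw [key, mul_pow]
  gcongr
  exact h _ (hS.hasEigenvalue_eigenvalues hn i)

end Involutions

/-! ### The function $b$ in terms of $\lambda^2-2$ -/

theorem b_nonneg (l : ℝ) : 0 ≤ b l := by unfold b; positivity

/-- For $l^2>4$ the square root is $0$ by convention, while the left side $l^2(4-l^2)$ is negative;
so eigenvalues need no a priori bound. -/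
theorem le_b_sq (l : ℝ) : 4 - (l ^ 2 - 2) ^ 2 ≤ b l ^ 2 := by
  rw [b, mul_pow, sq_abs]
  have : 4 - l ^ 2 ≤ √(4 - l ^ 2) ^ 2 := by
    rcases le_total 0 (4 - l ^ 2) with h | h
    · rw [Real.sq_sqrt h]
    · exact h.trans (sq_nonneg _)
  nlinarith [sq_nonneg l]

theorem b_sq {l : ℝ} (h : l ^ 2 ≤ 4) : b l ^ 2 = 4 - (l ^ 2 - 2) ^ 2 := by
  rw [b, mul_pow, sq_abs, Real.sq_sqrt (by linarith)]
  ring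

/-! ### Commutators along the finite dimensional approximations -/

section Approximation

variable {V : Type*} [NormedAddCommGroup V] [InnerProductSpace ℂ V]

/-- The commutator of the two reflections of a finite dimensional pair. -/
def FiniteDimPair.commutator (X : FiniteDimPair V) (x : X.space) : X.space :=
  linearReflection X.P (linearReflection X.Q x) - linearReflection X.Q (linearReflection X.P x)

theorem FiniteDimPair.norm_commutator_le (X : FiniteDimPair V) {l : ℝ}
    (hl : IsNearestEigenvalue X l) (x : X.space) : ‖X.commutator x‖ ≤ b l * ‖x‖ := by
  have := X.finiteDimensional
  have hP := X.isSymmetricProjection_P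
  have hQ := X.isSymmetricProjection_Q
  have h1 := norm_commutator_sq_add_norm_sq (linearReflection_involutive hP)
    (linearReflection_involutive hQ) (norm_linearReflection hP)
    (norm_linearReflection hQ) x
  have h2 := le_norm_apply_apply_sub_two_smul (S := X.sumOp)
    ((linearReflection_isSymmetric hP).add
      (linearReflection_isSymmetric hQ)) (abs_nonneg _) hl.2 x
  have h3 := pow_le_pow_left₀ (by positivity) h2 2
  rw [mul_pow, sq_abs] at h3
  refine (sq_le_sq₀ (norm_nonneg _) (mul_nonneg (b_nonneg l) (norm_nonneg _))).1 ?_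
  rw [mul_pow]
  have h4 := mul_le_mul_of_nonneg_right (le_b_sq l) (sq_nonneg ‖x‖)
  change ‖X.commutator x‖ ^ 2 + ‖X.sumOp (X.sumOp x) - (2 : ℂ) • x‖ ^ 2 = _ at h1
  linarith

/-- The vectors on which the approximating projections eventually agree with `P` and `Q`. -/
def exactVectors (P Q : V →L[ℂ] V) (𝒜 : ℕ → FiniteDimPair V) : Submodule ℂ V where
  carrier := {x | ∀ᶠ n in atTop, ∃ y : (𝒜 n).space, (y : V) = x ∧
    ((𝒜 n).P y : V) = P x ∧ ((𝒜 n).Q y : V) = Q x}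
  zero_mem' := Eventually.of_forall fun n => ⟨0, by simp⟩
  add_mem' := by
    intro x x' hx hx'
    filter_upwards [hx, hx'] with n ⟨y, h1, h2, h3⟩ ⟨y', h1', h2', h3'⟩
    exact ⟨y + y', by simp [h1, h1'], by simp [h2, h2'], by simp [h3, h3']⟩
  smul_mem' := by
    intro c x hx
    filter_upwards [hx] with n ⟨y, h1, h2, h3⟩
    exact ⟨c • y, by simp [h1], by simp [h2], by simp [h3]⟩

/-- The commutator applies $P$ to $Qx$ and $Q$ to $Px$, so exactness is needed at these vectors as
well as at $x$. -/
theorem eventually_commutator_eq {P Q : V →L[ℂ] V} {𝒜 : ℕ → FiniteDimPair V} {x : V}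
    (hx : x ∈ exactVectors P Q 𝒜) (hPx : P x ∈ exactVectors P Q 𝒜)
    (hQx : Q x ∈ exactVectors P Q 𝒜) :
    ∀ᶠ n in atTop, ∃ y : (𝒜 n).space, (y : V) = x ∧
      ((𝒜 n).commutator y : V)
        = (reflection P * reflection Q - reflection Q * reflection P) x := by
  filter_upwards [hx, hPx, hQx] with n ⟨y, h1, h2, h3⟩ ⟨p, p1, _, p3⟩ ⟨q, q1, q2, _⟩
  have hp : (𝒜 n).P y = p := Subtype.ext (h2.trans p1.symm)
  have hq : (𝒜 n).Q y = q := Subtype.ext (h3.trans q1.symm)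
  refine ⟨y, h1, ?_⟩
  simp [FiniteDimPair.commutator, linearReflection_apply, reflection, hp, hq, p1, p3, q1, q2, h1]

theorem IsDecompositionApprox.le_exactVectors {P Q : V →L[ℂ] V} {ι : Type}
    {W : ι → Submodule ℂ V} {I : ℕ → Finset ι} {𝒜 : ℕ → FiniteDimPair V}
    (h : IsDecompositionApprox P Q W I 𝒜) : ⨆ i, W i ≤ exactVectors P Q 𝒜 := by
  refine iSup_le fun i x hx => ?_
  obtain ⟨m, hm⟩ := h.exhaust i
  filter_upwards [eventually_ge_atTop m] with n hn
  have hmem : x ∈ (𝒜 n).space := by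
    rw [h.space_eq]
    exact Submodule.mem_iSup_of_mem i (Submodule.mem_iSup_of_mem (h.monotone hn hm) hx)
  exact ⟨⟨x, hmem⟩, rfl, h.P_apply n _, h.Q_apply n _⟩

theorem IsOneShiftedApprox.le_exactVectors {P Q : V →L[ℂ] V} {e : HilbertBasis ℕ ℂ V}
    {𝒜 : ℕ → FiniteDimPair V} (h : IsOneShiftedApprox P Q e 𝒜) :
    Submodule.span ℂ (Set.range e) ≤ exactVectors P Q 𝒜 := by
  rw [Submodule.span_le]
  rintro _ ⟨j, rfl⟩
  change ∀ᶠ n in atTop, _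
  -- From $n\ge j$ follows $j<2n+1$, which keeps $e_j$ away from the last basis vector, where $Q_n$
  -- differs from $Q$.
  filter_upwards [eventually_ge_atTop j] with n hn
  have hmem : e j ∈ (𝒜 n).space := by
    rw [h.space_eq]
    exact Submodule.subset_span ⟨j, by simp only [Set.mem_ofPred_eq]; omega, rfl⟩
  exact ⟨⟨e j, hmem⟩, rfl, h.P_apply n _, h.Q_apply n j (by omega) _ rfl⟩

theorem ActsAsBlock.mem {T : V →L[ℂ] V} {t : ℝ} {x y : V} (h : ActsAsBlock T t x y)
    {D : Submodule ℂ V} (hx : x ∈ D) (hy : y ∈ D) : T x ∈ D ∧ T y ∈ D := by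
  rw [h.1, h.2]
  exact ⟨D.add_mem (D.smul_mem _ hx) (D.smul_mem _ hy),
    D.add_mem (D.smul_mem _ hx) (D.smul_mem _ hy)⟩

theorem IsOneShifted.span_le_comap {P Q : V →L[ℂ] V} {e : HilbertBasis ℕ ℂ V} {θ : ℕ → ℝ}
    (h : IsOneShifted P Q e θ) :
    Submodule.span ℂ (Set.range e) ≤ (Submodule.span ℂ (Set.range e)).comap P.toLinearMap ∧
      Submodule.span ℂ (Set.range e) ≤ (Submodule.span ℂ (Set.range e)).comap Q.toLinearMap := by
  have he (j : ℕ) : e j ∈ Submodule.span ℂ (Set.range e) := Submodule.subset_span ⟨j, rfl⟩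
  constructor <;> rw [Submodule.span_le] <;> rintro _ ⟨j, rfl⟩
  · obtain ⟨k, rfl | rfl⟩ := Nat.even_or_odd' j
    · exact ((h.P_block k).mem (he _) (he _)).1
    · exact ((h.P_block k).mem (he _) (he _)).2
  · obtain ⟨k, rfl | rfl⟩ := Nat.even_or_odd' j
    · cases k with
      | zero =>
        change Q (e 0) ∈ Submodule.span ℂ (Set.range e)
        rw [h.Q_zero]
        exact he 0
      | succ k => exact ((h.Q_block k).mem (he _) (he _)).2
    · exact ((h.Q_block k).mem (he _) (he _)).1

/-- This is all that the upper bound uses about the two cases. -/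
theorem IsCanonicalApprox.exists_dense_invariant {P Q : V →L[ℂ] V} {𝒜 : ℕ → FiniteDimPair V}
    (h : IsCanonicalApprox P Q 𝒜) :
    ∃ D : Submodule ℂ V, D.topologicalClosure = ⊤ ∧ D ≤ exactVectors P Q 𝒜 ∧
      D ≤ D.comap P.toLinearMap ∧ D ≤ D.comap Q.toLinearMap := by
  cases h with
  | decomposition ι hι W I hW h𝒜 =>
    exact ⟨⨆ i, W i, hW.dense, h𝒜.le_exactVectors,
      iSup_le fun i x hx => Submodule.mem_iSup_of_mem i (hW.map_P i x hx),
      iSup_le fun i x hx => Submodule.mem_iSup_of_mem i (hW.map_Q i x hx)⟩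
  | oneShifted hPQ e θ he h𝒜 =>
    exact ⟨_, e.dense_span, h𝒜.le_exactVectors, he.span_le_comap.1, he.span_le_comap.2⟩

theorem opNorm_le_of_dense {T : V →L[ℂ] V} {D : Submodule ℂ V} (hD : D.topologicalClosure = ⊤)
    {c : ℝ} (hc : 0 ≤ c) (h : ∀ x ∈ D, ‖T x‖ ≤ c * ‖x‖) : ‖T‖ ≤ c := by
  refine T.opNorm_le_bound hc fun x => ?_
  have hd : Dense (D : Set V) := Submodule.dense_iff_topologicalClosure_eq_top.2 hD
  exact hd.induction (P := fun x => ‖T x‖ ≤ c * ‖x‖) h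
    (isClosed_le (by fun_prop) (by fun_prop)) x

/-- The operator `[A, B] = AB - BA`, where `A = 2P - id` and `B = 2Q - id`. -/
def commutatorOp (P Q : V →L[ℂ] V) : V →L[ℂ] V :=
  reflection P * reflection Q - reflection Q * reflection P

/-- The sequence `b (lam n)` need not converge, but its truncation does, so products and square
roots can be handled by continuity. If $c<\|C\|$, some $x$ in the dense subspace has
$\|Cx\|>c\|x\|$, and exactness at $x$ forces $c<b(\lambda_n)$ for large $n$. -/
theorem IsCanonicalApprox.tendsto_min {P Q : V →L[ℂ] V} {𝒜 : ℕ → FiniteDimPair V}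
    (h : IsCanonicalApprox P Q 𝒜) {lam : ℕ → ℝ}
    (hlam : ∀ᶠ n in atTop, IsNearestEigenvalue (𝒜 n) (lam n)) :
    Tendsto (fun n => min ‖commutatorOp P Q‖ (b (lam n))) atTop (𝓝 ‖commutatorOp P Q‖) := by
  obtain ⟨D, hD, hex, hP, hQ⟩ := h.exists_dense_invariant
  refine tendsto_order.2 ⟨fun c hc => ?_, fun c hc => Eventually.of_forall fun n =>
    (min_le_left _ _).trans_lt hc⟩
  rcases lt_or_ge c 0 with h0 | h0
  · exact Eventually.of_forall fun n => lt_min hc (h0.trans_le (b_nonneg _))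
  obtain ⟨x, hx, hcx⟩ : ∃ x ∈ D, c * ‖x‖ < ‖commutatorOp P Q x‖ := by
    by_contra! hcon
    exact hc.not_ge (opNorm_le_of_dense hD h0 hcon)
  filter_upwards [hlam, eventually_commutator_eq (hex hx) (hex (hP hx)) (hex (hQ hx))]
    with n hn ⟨y, hy, hyx⟩
  refine lt_min hc ?_
  have hle := (𝒜 n).norm_commutator_le hn y
  rw [Submodule.coe_norm, Submodule.coe_norm, hyx, hy] at hle
  exact lt_of_mul_lt_mul_right (hcx.trans_le hle) (norm_nonneg x)

end Approximation

/-! ### The commutator of two reflections on a Hilbert space -/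

section Reflections

variable {V : Type*} [NormedAddCommGroup V] [InnerProductSpace ℂ V] [CompleteSpace V]
  {P Q : V →L[ℂ] V}

theorem isSymmetricProjection_of_isStarProjection (hP : IsStarProjection P) :
    P.toLinearMap.IsSymmetricProjection where
  isIdempotentElem := LinearMap.ext fun x =>
    DFunLike.congr_fun hP.isIdempotentElem x
  isSymmetric := ContinuousLinearMap.isSelfAdjoint_iff_isSymmetric.1 hP.isSelfAdjoint

theorem reflection_isSelfAdjoint (hP : IsStarProjection P) : IsSelfAdjoint (reflection P) :=
  ContinuousLinearMap.isSelfAdjoint_iff_isSymmetric.2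
    (linearReflection_isSymmetric (isSymmetricProjection_of_isStarProjection hP))

theorem reflection_mul_self (hP : IsStarProjection P) : reflection P * reflection P = 1 :=
  ContinuousLinearMap.ext fun x =>
    linearReflection_involutive (isSymmetricProjection_of_isStarProjection hP) x

theorem norm_reflection_apply (hP : IsStarProjection P) (x : V) : ‖reflection P x‖ = ‖x‖ :=
  norm_linearReflection (isSymmetricProjection_of_isStarProjection hP) x

theorem norm_commutatorOp_sq_add_norm_sq (hP : IsStarProjection P) (hQ : IsStarProjection Q)
    (x : V) : ‖commutatorOp P Q x‖ ^ 2 + ‖sumOp P Q (sumOp P Q x) - (2 : ℂ) • x‖ ^ 2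
      = 4 * ‖x‖ ^ 2 :=
  norm_commutator_sq_add_norm_sq
    (linearReflection_involutive (isSymmetricProjection_of_isStarProjection hP))
    (linearReflection_involutive (isSymmetricProjection_of_isStarProjection hQ))
    (norm_reflection_apply hP) (norm_reflection_apply hQ) x

theorem b_le_norm_commutatorOp (hP : IsStarProjection P) (hQ : IsStarProjection Q)
    {𝒜 : ℕ → FiniteDimPair V} {l : ℝ} (hl : l ∈ Ftilde P Q 𝒜) :
    b l ≤ ‖commutatorOp P Q‖ := by
  rcases hl with ⟨⟨h0, h2⟩, ⟨lam, u, hu, hlam, hlim⟩, -⟩ | rfl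
  swap
  · simp [b]
  set S := sumOp P Q
  -- The $u_n$ are approximate eigenvectors of $S$ for $l$, hence of $S^2$ for $l^2$.
  have h1 : Tendsto (fun n => S (u n : V) - (l : ℂ) • (u n : V)) atTop (𝓝 0) := by
    rw [tendsto_zero_iff_norm_tendsto_zero]
    have h3 : Tendsto (fun n => ‖S (u n : V) - ((𝒜 n).sumOp (u n) : V)‖ + |lam n - l|) atTop
        (𝓝 0) := by
      simpa using hlim.add (hlam.sub_const l).abs
    refine squeeze_zero' (Eventually.of_forall fun _ => norm_nonneg _) ?_ h3
    filter_upwards [hu] with n ⟨hn, hn'⟩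
    have : S (u n : V) - (l : ℂ) • (u n : V) = (S (u n : V) - ((𝒜 n).sumOp (u n) : V))
        + ((lam n - l : ℝ) : ℂ) • (u n : V) := by
      rw [hn', Submodule.coe_smul]
      push_cast
      rw [sub_smul]
      abel
    rw [this]
    refine (norm_add_le _ _).trans ?_
    rw [norm_smul, Complex.norm_real, ← Submodule.coe_norm, hn, mul_one, Real.norm_eq_abs]
  have h4 : Tendsto (fun n => S (S (u n : V)) - ((l ^ 2 : ℝ) : ℂ) • (u n : V)) atTop (𝓝 0) := by
    have := ((S.continuous.tendsto 0).comp h1).add (h1.const_smul (l : ℂ))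
    rw [map_zero, smul_zero, add_zero] at this
    refine this.congr fun n => ?_
    simp only [Function.comp_apply, map_sub, map_smul, smul_sub, smul_smul]
    push_cast
    rw [sq]
    abel
  have h5 : Tendsto (fun n => |l ^ 2 - 2| + ‖S (S (u n : V)) - ((l ^ 2 : ℝ) : ℂ) • (u n : V)‖)
      atTop (𝓝 |l ^ 2 - 2|) := by
    simpa using h4.norm.const_add |l ^ 2 - 2|
  have h6 := (h5.pow 2).const_sub 4
  rw [sq_abs, ← b_sq (by nlinarith)] at h6
  -- The norm identity at $u_n$ bounds $\|C\|^2$ below by a quantity tending to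
  -- $4-(l^2-2)^2=b(l)^2$.
  refine (sq_le_sq₀ (b_nonneg l) (norm_nonneg _)).1 (le_of_tendsto h6 ?_)
  filter_upwards [hu] with n ⟨hn, _⟩
  have hn1 : ‖(u n : V)‖ = 1 := hn
  have h7 := norm_commutatorOp_sq_add_norm_sq hP hQ (u n : V)
  have h8 : ‖S (S (u n : V)) - (2 : ℂ) • (u n : V)‖
      ≤ |l ^ 2 - 2| + ‖S (S (u n : V)) - ((l ^ 2 : ℝ) : ℂ) • (u n : V)‖ := by
    have : S (S (u n : V)) - (2 : ℂ) • (u n : V) = ((l ^ 2 - 2 : ℝ) : ℂ) • (u n : V)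
        + (S (S (u n : V)) - ((l ^ 2 : ℝ) : ℂ) • (u n : V)) := by
      push_cast
      rw [sub_smul]
      abel
    rw [this]
    refine (norm_add_le _ _).trans ?_
    rw [norm_smul, Complex.norm_real, hn1, mul_one, Real.norm_eq_abs]
  have h9 := pow_le_pow_left₀ (norm_nonneg _) h8 2
  have h10 := pow_le_pow_left₀ (norm_nonneg _) ((commutatorOp P Q).le_opNorm (u n : V)) 2
  rw [hn1] at h7 h10
  rw [mul_one] at h10
  linarith

theorem isSelfAdjoint_I_smul_commutatorOp (hP : IsStarProjection P) (hQ : IsStarProjection Q) :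
    IsSelfAdjoint (Complex.I • commutatorOp P Q) := by
  rw [IsSelfAdjoint, star_smul, commutatorOp, star_sub, star_mul, star_mul,
    (reflection_isSelfAdjoint hP).star_eq, (reflection_isSelfAdjoint hQ).star_eq]
  simp [smul_sub, ← sub_eq_neg_add]

theorem rayleighQuotient_comp_of_anticommute {C A : V →L[ℂ] V}
    (hA : IsSelfAdjoint A) (hA1 : A * A = 1) (nA : ∀ x, ‖A x‖ = ‖x‖) (hCA : C * A = -(A * C))
    (x : V) : C.rayleighQuotient (A x) = -C.rayleighQuotient x := by
  have h1 : C (A x) = -A (C x) := DFunLike.congr_fun hCA x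
  have h2 : A (A x) = x := DFunLike.congr_fun hA1 x
  have h3 := ContinuousLinearMap.isSelfAdjoint_iff_isSymmetric.1 hA (C x) (A x)
  simp only [ContinuousLinearMap.coe_coe, h2] at h3
  simp [ContinuousLinearMap.rayleighQuotient, ContinuousLinearMap.reApplyInnerSelf_apply, h1, nA,
    h3, neg_div]

/-- The norm of a self-adjoint operator is the supremum of the absolute Rayleigh quotients;
replacing $y$ by $Ay$ flips a negative sign. -/
theorem exists_tendsto_rayleighQuotient [Nontrivial V] {C A : V →L[ℂ] V} (hC : IsSelfAdjoint C)
    (hA : IsSelfAdjoint A) (hA1 : A * A = 1) (nA : ∀ x, ‖A x‖ = ‖x‖) (hCA : C * A = -(A * C)) :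
    ∃ x : ℕ → V, (∀ n, x n ≠ 0) ∧
      Tendsto (fun n => C.rayleighQuotient (x n)) atTop (𝓝 ‖C‖) := by
  have key (c : ℝ) (hc : c < ‖C‖) : ∃ x ≠ 0, c < C.rayleighQuotient x := by
    rw [C.norm_eq_iSup_rayleighQuotient
      (ContinuousLinearMap.isSelfAdjoint_iff_isSymmetric.1 hC)] at hc
    obtain ⟨x, hx⟩ := exists_lt_of_lt_ciSup hc
    obtain ⟨y, hy, hcy⟩ : ∃ y ≠ 0, c < |C.rayleighQuotient y| := by
      -- The supremum also ranges over $x=0$, where the quotient is $0$; any nonzero vector does at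
      -- least as well.
      by_cases h : x = 0
      · obtain ⟨y, hy⟩ := exists_ne (0 : V)
        rw [h, ContinuousLinearMap.rayleighQuotient_apply_zero, abs_zero] at hx
        exact ⟨y, hy, hx.trans_le (abs_nonneg _)⟩
      · exact ⟨x, h, hx⟩
    rcases lt_abs.1 hcy with h | h
    · exact ⟨y, hy, h⟩
    · refine ⟨A y, ?_, by rwa [rayleighQuotient_comp_of_anticommute hA hA1 nA hCA]⟩
      rwa [← norm_ne_zero_iff, nA, norm_ne_zero_iff]
  choose x hx0 hx using fun n : ℕ => key (‖C‖ - 1 / ((n : ℝ) + 1))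
    (sub_lt_self _ Nat.one_div_pos_of_nat)
  refine ⟨x, hx0, tendsto_of_tendsto_of_tendsto_of_le_of_le ?_ tendsto_const_nhds
    (fun n => (hx n).le) fun n => (le_abs_self _).trans (C.rayleighQuotient_le_norm _)⟩
  simpa using tendsto_one_div_add_atTop_nhds_zero_nat.const_sub ‖C‖

/-- The anticommutation comes from $A^2=1$: both $A[A,B]$ and $-[A,B]A$ equal $B-ABA$. -/
theorem exists_tendsto_rayleighQuotient_commutatorOp [Nontrivial V] (hP : IsStarProjection P)
    (hQ : IsStarProjection Q) : ∃ x : ℕ → V, (∀ n, x n ≠ 0) ∧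
      Tendsto (fun n => (Complex.I • commutatorOp P Q).rayleighQuotient (x n)) atTop
        (𝓝 ‖commutatorOp P Q‖) := by
  have h := exists_tendsto_rayleighQuotient (isSelfAdjoint_I_smul_commutatorOp hP hQ)
    (reflection_isSelfAdjoint hP) (reflection_mul_self hP) (norm_reflection_apply hP) (by
      rw [smul_mul_assoc, mul_smul_comm, ← smul_neg, commutatorOp, sub_mul, mul_sub,
        ← mul_assoc (reflection P), reflection_mul_self hP, mul_assoc (reflection Q),
        reflection_mul_self hP]
      simp [mul_assoc, smul_sub])
  simpa [norm_smul] using h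

end Reflections

/-! ### Operators on the Hilbert tensor product and the square of $\mathcal B$ -/

section Tensor

variable {V W : Type*} [NormedAddCommGroup V] [InnerProductSpace ℂ V]
  [NormedAddCommGroup W] [InnerProductSpace ℂ W]

theorem hilbertTensor_clm_ext {f g : HilbertTensor V W →L[ℂ] HilbertTensor V W}
    (h : ∀ (x : V) (y : W), f ((x ⊗ₜ[ℂ] y : V ⊗[ℂ] W) : HilbertTensor V W)
      = g ((x ⊗ₜ[ℂ] y : V ⊗[ℂ] W) : HilbertTensor V W)) : f = g := by
  ext z
  induction z using UniformSpace.Completion.induction_on with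
  | hp => exact isClosed_eq f.continuous g.continuous
  | ih t =>
    induction t using TensorProduct.induction_on with
    | zero => rw [UniformSpace.Completion.coe_zero, map_zero, map_zero]
    | tmul x y => exact h x y
    | add s t hs ht => rw [UniformSpace.Completion.coe_add, map_add, map_add, hs, ht]

theorem tensorOp_tmul (S : V →L[ℂ] V) (T : W →L[ℂ] W) (x : V) (y : W) :
    tensorOp S T ((x ⊗ₜ[ℂ] y : V ⊗[ℂ] W) : HilbertTensor V W)
      = ((S x ⊗ₜ[ℂ] T y : V ⊗[ℂ] W) : HilbertTensor V W) := by
  rw [tensorOp_coe, TensorProduct.mapL_tmul]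

theorem tensorOp_mul (S S' : V →L[ℂ] V) (T T' : W →L[ℂ] W) :
    tensorOp S T * tensorOp S' T' = tensorOp (S * S') (T * T') :=
  hilbertTensor_clm_ext fun x y => by
    simp only [mul_apply_eq_comp, tensorOp_tmul]

theorem tensorOp_add_right (S : V →L[ℂ] V) (T T' : W →L[ℂ] W) :
    tensorOp S (T + T') = tensorOp S T + tensorOp S T' :=
  hilbertTensor_clm_ext fun x y => by
    simp only [add_apply, tensorOp_tmul, TensorProduct.tmul_add,
      UniformSpace.Completion.coe_add]

theorem tensorOp_sub_left (S S' : V →L[ℂ] V) (T : W →L[ℂ] W) :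
    tensorOp (S - S') T = tensorOp S T - tensorOp S' T :=
  hilbertTensor_clm_ext fun x y => by
    simp only [sub_apply, tensorOp_tmul, TensorProduct.sub_tmul,
      UniformSpace.Completion.coe_sub]

theorem tensorOp_neg_right (S : V →L[ℂ] V) (T : W →L[ℂ] W) :
    tensorOp S (-T) = -tensorOp S T :=
  hilbertTensor_clm_ext fun x y => by
    simp only [neg_apply, tensorOp_tmul, TensorProduct.tmul_neg,
      UniformSpace.Completion.coe_neg]

theorem tensorOp_smul_smul (c d : ℂ) (S : V →L[ℂ] V) (T : W →L[ℂ] W) :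
    tensorOp (c • S) (d • T) = (c * d) • tensorOp S T :=
  hilbertTensor_clm_ext fun x y => by
    simp only [smul_apply, tensorOp_tmul, TensorProduct.smul_tmul_smul,
      UniformSpace.Completion.coe_smul]

theorem tensorOp_one_one : tensorOp (1 : V →L[ℂ] V) (1 : W →L[ℂ] W) = 1 :=
  hilbertTensor_clm_ext fun x y => by
    simp only [one_apply_eq_self, tensorOp_tmul]

theorem norm_tensorOp_le (S : V →L[ℂ] V) (T : W →L[ℂ] W) : ‖tensorOp S T‖ ≤ ‖S‖ * ‖T‖ := by
  refine ContinuousLinearMap.opNorm_le_bound _ (by positivity) fun z => ?_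
  induction z using UniformSpace.Completion.induction_on with
  | hp => exact isClosed_le (by fun_prop) (by fun_prop)
  | ih t =>
    rw [tensorOp_coe, UniformSpace.Completion.norm_coe, UniformSpace.Completion.norm_coe]
    exact (TensorProduct.mapL S T).le_of_opNorm_le (TensorProduct.norm_mapL_le S T) t

theorem isSelfAdjoint_tensorOp [CompleteSpace V] [CompleteSpace W] {S : V →L[ℂ] V}
    {T : W →L[ℂ] W} (hS : IsSelfAdjoint S) (hT : IsSelfAdjoint T) :
    IsSelfAdjoint (tensorOp S T) := by
  rw [ContinuousLinearMap.isSelfAdjoint_iff_isSymmetric] at *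
  intro z w
  simp only [ContinuousLinearMap.coe_coe]
  induction z, w using UniformSpace.Completion.induction_on₂ with
  | hp => exact isClosed_eq (by fun_prop) (by fun_prop)
  | ih s t =>
    simp only [tensorOp_coe, UniformSpace.Completion.inner_coe]
    induction s using TensorProduct.induction_on with
    | zero => simp
    | add s s' hs hs' => rw [map_add, inner_add_left, inner_add_left, hs, hs']
    | tmul x y =>
      induction t using TensorProduct.induction_on with
      | zero => simp
      | add t t' ht ht' => rw [map_add, inner_add_right, inner_add_right, ht, ht']
      | tmul x' y' =>
        rw [TensorProduct.mapL_tmul, TensorProduct.mapL_tmul, TensorProduct.inner_tmul,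
          TensorProduct.inner_tmul]
        congr 1
        · exact hS x x'
        · exact hT y y'

theorem isSelfAdjoint_bellCHSH [CompleteSpace V] [CompleteSpace W] {A₁ A₂ : V →L[ℂ] V}
    {B₁ B₂ : W →L[ℂ] W} (hA₁ : IsSelfAdjoint A₁) (hA₂ : IsSelfAdjoint A₂)
    (hB₁ : IsSelfAdjoint B₁) (hB₂ : IsSelfAdjoint B₂) :
    IsSelfAdjoint (bellCHSH A₁ A₂ B₁ B₂) := by
  have h1 := isSelfAdjoint_tensorOp hA₁ (hB₁.add hB₂)
  have h2 := isSelfAdjoint_tensorOp hA₂ (hB₁.sub hB₂)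
  rw [ContinuousLinearMap.isSelfAdjoint_iff_isSymmetric] at *
  exact h1.add h2

/-- The square terms add up to $1\otimes((B_1+B_2)^2+(B_1-B_2)^2)=4$ and the cross terms to
$-[A_1,A_2]\otimes[B_1,B_2]$. The two factors $i$ absorb the sign and turn commutators of
self-adjoint operators into self-adjoint operators. -/
theorem bellCHSH_mul_self {A₁ A₂ : V →L[ℂ] V} {B₁ B₂ : W →L[ℂ] W} (hA₁ : A₁ * A₁ = 1)
    (hA₂ : A₂ * A₂ = 1) (hB₁ : B₁ * B₁ = 1) (hB₂ : B₂ * B₂ = 1) :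
    bellCHSH A₁ A₂ B₁ B₂ * bellCHSH A₁ A₂ B₁ B₂
      = (4 : ℂ) • 1 + tensorOp (Complex.I • (A₁ * A₂ - A₂ * A₁))
          (Complex.I • (B₁ * B₂ - B₂ * B₁)) := by
  have h1 : (B₁ + B₂) * (B₁ + B₂) + (B₁ - B₂) * (B₁ - B₂) = 1 + 1 + 1 + 1 := by
    simp only [add_mul, mul_add, sub_mul, mul_sub, hB₁, hB₂]
    abel
  have h2 : (B₁ + B₂) * (B₁ - B₂) = -(B₁ * B₂ - B₂ * B₁) := by
    simp only [add_mul, mul_sub, hB₁, hB₂]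
    abel
  have h3 : (B₁ - B₂) * (B₁ + B₂) = B₁ * B₂ - B₂ * B₁ := by
    simp only [sub_mul, mul_add, hB₁, hB₂]
    abel
  have h4 : tensorOp (1 : V →L[ℂ] V) ((B₁ + B₂) * (B₁ + B₂))
      + tensorOp 1 ((B₁ - B₂) * (B₁ - B₂)) = (4 : ℂ) • 1 := by
    rw [← tensorOp_add_right, h1]
    simp only [tensorOp_add_right, tensorOp_one_one]
    module
  rw [tensorOp_smul_smul, Complex.I_mul_I, neg_one_smul, tensorOp_sub_left, ← h4, bellCHSH,
    add_mul, mul_add, mul_add]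
  simp only [tensorOp_mul, hA₁, hA₂, h2, h3, tensorOp_neg_right]
  abel

theorem rayleighQuotient_tensorOp_tmul [CompleteSpace V] {S : V →L[ℂ] V} {T : W →L[ℂ] W}
    (hS : IsSelfAdjoint S) (x : V) (y : W) :
    (tensorOp S T).rayleighQuotient ((x ⊗ₜ[ℂ] y : V ⊗[ℂ] W) : HilbertTensor V W)
      = S.rayleighQuotient x * T.rayleighQuotient y := by
  -- One real factor is enough for the real part of the product to be the product of the real parts.
  have h : (RCLike.im (inner ℂ (S x) x : ℂ) : ℝ) = 0 :=
    (ContinuousLinearMap.isSelfAdjoint_iff_isSymmetric.1 hS).im_inner_apply_self x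
  simp only [ContinuousLinearMap.rayleighQuotient, ContinuousLinearMap.reApplyInnerSelf_apply,
    tensorOp_tmul, UniformSpace.Completion.inner_coe, UniformSpace.Completion.norm_coe,
    TensorProduct.inner_tmul, TensorProduct.norm_tmul, RCLike.mul_re, h, mul_pow]
  rw [zero_mul, sub_zero, mul_div_mul_comm]

theorem rayleighQuotient_smul_one {E : Type*} [NormedAddCommGroup E] [InnerProductSpace ℂ E]
    (r : ℝ) {x : E} (hx : x ≠ 0) :
    ((r : ℂ) • (1 : E →L[ℂ] E)).rayleighQuotient x = r := by
  have : ‖x‖ ^ 2 ≠ 0 := by positivity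
  rw [ContinuousLinearMap.rayleighQuotient, ContinuousLinearMap.reApplyInnerSelf_apply,
    div_eq_iff this, smul_apply, one_apply_eq_self,
    inner_smul_left, inner_self_eq_norm_sq_to_K, Complex.conj_ofReal]
  change ((r : ℂ) * (‖x‖ : ℂ) ^ (2 : ℕ)).re = r * ‖x‖ ^ (2 : ℕ)
  rw [← Complex.ofReal_pow, ← Complex.ofReal_mul, Complex.ofReal_re]

theorem norm_mul_self_of_isSelfAdjoint {E : Type*} [NormedAddCommGroup E]
    [InnerProductSpace ℂ E] [CompleteSpace E] {T : E →L[ℂ] E} (hT : IsSelfAdjoint T) :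
    ‖T * T‖ = ‖T‖ ^ 2 := by
  rw [sq, ← CStarRing.norm_star_mul_self, hT.star_eq]

theorem spectralRadius_eq_of_norm_sq_eq {E : Type*} [NormedAddCommGroup E]
    [InnerProductSpace ℂ E] [CompleteSpace E] {T : E →L[ℂ] E} (hT : IsSelfAdjoint T) {c : ℝ}
    (hc : ‖T‖ ^ 2 = c) : spectralRadius ℂ T = ENNReal.ofReal √c := by
  rw [hT.spectralRadius_eq_nnnorm, ← hc, Real.sqrt_sq (norm_nonneg _), ofReal_norm,
    enorm_eq_nnnorm]

end Tensor

/-! ### Norm and spectral radius of $\mathcal B$ -/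

variable {V₁ : Type*} [NormedAddCommGroup V₁] [InnerProductSpace ℂ V₁] [CompleteSpace V₁]
  [Nontrivial V₁] {V₂ : Type*} [NormedAddCommGroup V₂] [InnerProductSpace ℂ V₂]
  [CompleteSpace V₂] [Nontrivial V₂]

theorem norm_bellCHSH_sq {P₁ Q₁ : V₁ →L[ℂ] V₁} (hP₁ : IsStarProjection P₁)
    (hQ₁ : IsStarProjection Q₁) {P₂ Q₂ : V₂ →L[ℂ] V₂} (hP₂ : IsStarProjection P₂)
    (hQ₂ : IsStarProjection Q₂) :
    ‖bellCHSH (reflection P₁) (reflection Q₁) (reflection P₂) (reflection Q₂)‖ ^ 2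
      = 4 + ‖commutatorOp P₁ Q₁‖ * ‖commutatorOp P₂ Q₂‖ := by
  have hsq := bellCHSH_mul_self (reflection_mul_self hP₁) (reflection_mul_self hQ₁)
    (reflection_mul_self hP₂) (reflection_mul_self hQ₂)
  rw [← commutatorOp, ← commutatorOp] at hsq
  have hsa := isSelfAdjoint_bellCHSH (reflection_isSelfAdjoint hP₁)
    (reflection_isSelfAdjoint hQ₁) (reflection_isSelfAdjoint hP₂) (reflection_isSelfAdjoint hQ₂)
  rw [← norm_mul_self_of_isSelfAdjoint hsa, hsq]
  set C := Complex.I • commutatorOp P₁ Q₁ with hC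
  set D := Complex.I • commutatorOp P₂ Q₂ with hD
  have nC : ‖C‖ = ‖commutatorOp P₁ Q₁‖ := by simp [hC, norm_smul]
  have nD : ‖D‖ = ‖commutatorOp P₂ Q₂‖ := by simp [hD, norm_smul]
  refine le_antisymm ?_ ?_
  · refine (norm_add_le _ _).trans (add_le_add ?_ ?_)
    · rw [norm_smul, RCLike.norm_ofNat]
      exact mul_le_of_le_one_right (by norm_num) ContinuousLinearMap.norm_id_le
    · rw [← nC, ← nD]
      exact norm_tensorOp_le C D
  · obtain ⟨x, hx0, hx⟩ := exists_tendsto_rayleighQuotient_commutatorOp hP₁ hQ₁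
    obtain ⟨y, hy0, hy⟩ := exists_tendsto_rayleighQuotient_commutatorOp hP₂ hQ₂
    refine le_of_tendsto ((hx.mul hy).const_add 4) (Eventually.of_forall fun n => ?_)
    have hxy : ((x n ⊗ₜ[ℂ] y n : V₁ ⊗[ℂ] V₂) : HilbertTensor V₁ V₂) ≠ 0 := by
      rw [← norm_ne_zero_iff, UniformSpace.Completion.norm_coe, TensorProduct.norm_tmul]
      exact mul_ne_zero (norm_ne_zero_iff.2 (hx0 n)) (norm_ne_zero_iff.2 (hy0 n))
    have h := rayleighQuotient_smul_one 4 hxy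
    rw [Complex.ofReal_ofNat] at h
    calc 4 + C.rayleighQuotient (x n) * D.rayleighQuotient (y n)
        = ((4 : ℂ) • 1 + tensorOp C D).rayleighQuotient
            ((x n ⊗ₜ[ℂ] y n : V₁ ⊗[ℂ] V₂) : HilbertTensor V₁ V₂) := by
          rw [ContinuousLinearMap.rayleighQuotient_add, h,
            rayleighQuotient_tensorOp_tmul (isSelfAdjoint_I_smul_commutatorOp hP₁ hQ₁)]
      _ ≤ _ := (le_abs_self _).trans (ContinuousLinearMap.rayleighQuotient_le_norm _ _)

theorem spectralRadius_bellCHSH {P₁ Q₁ : V₁ →L[ℂ] V₁} (hP₁ : IsStarProjection P₁)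
    (hQ₁ : IsStarProjection Q₁) {P₂ Q₂ : V₂ →L[ℂ] V₂} (hP₂ : IsStarProjection P₂)
    (hQ₂ : IsStarProjection Q₂) :
    spectralRadius ℂ (bellCHSH (reflection P₁) (reflection Q₁) (reflection P₂) (reflection Q₂))
      = ENNReal.ofReal √(4 + ‖commutatorOp P₁ Q₁‖ * ‖commutatorOp P₂ Q₂‖) :=
  spectralRadius_eq_of_norm_sq_eq
    (isSelfAdjoint_bellCHSH (reflection_isSelfAdjoint hP₁) (reflection_isSelfAdjoint hQ₁)
      (reflection_isSelfAdjoint hP₂) (reflection_isSelfAdjoint hQ₂))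
    (norm_bellCHSH_sq hP₁ hQ₁ hP₂ hQ₂)

end BellCHSH

end

theorem mainTheorem3
    {V₁ : Type*} [NormedAddCommGroup V₁] [InnerProductSpace ℂ V₁] [CompleteSpace V₁]
    [TopologicalSpace.SeparableSpace V₁] [Nontrivial V₁]
    {V₂ : Type*} [NormedAddCommGroup V₂] [InnerProductSpace ℂ V₂] [CompleteSpace V₂]
    [TopologicalSpace.SeparableSpace V₂] [Nontrivial V₂]
    (P₁ Q₁ : V₁ →L[ℂ] V₁) (hP₁ : IsStarProjection P₁) (hQ₁ : IsStarProjection Q₁)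
    (P₂ Q₂ : V₂ →L[ℂ] V₂) (hP₂ : IsStarProjection P₂) (hQ₂ : IsStarProjection Q₂)
    (𝒜₁ : ℕ → BellCHSH.FiniteDimPair V₁) (h𝒜₁ : BellCHSH.IsCanonicalApprox P₁ Q₁ 𝒜₁)
    (𝒜₂ : ℕ → BellCHSH.FiniteDimPair V₂) (h𝒜₂ : BellCHSH.IsCanonicalApprox P₂ Q₂ 𝒜₂)
    (lam₁ lam₂ : ℕ → ℝ)
    (hlam₁ : ∀ᶠ n in atTop, BellCHSH.IsNearestEigenvalue (𝒜₁ n) (lam₁ n))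
    (hlam₂ : ∀ᶠ n in atTop, BellCHSH.IsNearestEigenvalue (𝒜₂ n) (lam₂ n)) :
    (⨆ l ∈ BellCHSH.Ftilde P₁ Q₁ 𝒜₁, ⨆ l' ∈ BellCHSH.Ftilde P₂ Q₂ 𝒜₂,
        ENNReal.ofReal √(4 + BellCHSH.b l * BellCHSH.b l'))
      ≤ spectralRadius ℂ (BellCHSH.bellCHSH
          (BellCHSH.reflection P₁) (BellCHSH.reflection Q₁)
          (BellCHSH.reflection P₂) (BellCHSH.reflection Q₂)) ∧
    spectralRadius ℂ (BellCHSH.bellCHSH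
          (BellCHSH.reflection P₁) (BellCHSH.reflection Q₁)
          (BellCHSH.reflection P₂) (BellCHSH.reflection Q₂))
      ≤ liminf (fun n => ENNReal.ofReal √(4 + BellCHSH.b (lam₁ n) * BellCHSH.b (lam₂ n)))
          atTop := by
  rw [BellCHSH.spectralRadius_bellCHSH hP₁ hQ₁ hP₂ hQ₂]
  constructor
  · refine iSup₂_le fun l hl => iSup₂_le fun l' hl' => ?_
    gcongr
    · exact BellCHSH.b_nonneg _
    · exact BellCHSH.b_le_norm_commutatorOp hP₁ hQ₁ hl
    · exact BellCHSH.b_le_norm_commutatorOp hP₂ hQ₂ hl'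
  -- The truncated expression converges to the spectral radius and lies below the sequence of upper
  -- bounds.
  · have h := ENNReal.tendsto_ofReal
      (((h𝒜₁.tendsto_min hlam₁).mul (h𝒜₂.tendsto_min hlam₂)).const_add 4).sqrt
    rw [← h.liminf_eq]
    refine liminf_le_liminf (Eventually.of_forall fun n => ?_)
    gcongr
    · exact le_min (norm_nonneg _) (BellCHSH.b_nonneg _)
    · exact BellCHSH.b_nonneg _
    · exact min_le_right _ _
    · exact min_le_right _ _
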